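/- All vector spaces are real. A locally convex space is a Hausdorff locally convex topological vector space (for $E_1,E_2$ the Hausdorff property is not needed). Let $E_1,E_2,F$ be locally convex spaces, and let $U\subseteq E_1$ and $V\subseteq E_2$ be locally convex subsets with dense interior, that is, each point of $U$ (resp. $V$) has a convex neighbourhood in $U$ (resp. $V$), and the interior $U^\circ$ (resp. $V^\circ$) is dense in $U$ (resp. $V$). Let $r,s\in\mathbb{N}_0\cup\{\infty\}$. Write $D_hf(x)=\lim_{t\to 0}t^{-1}(f(x+th)-f(x))$. A map $f\colon U\to F$ is called $C^r$ if it is continuous and, for all $k\in\mathbb{N}_0$ with $k\le r$, the iterated directional derivatives $(D_{y_k}\cdots D_{y_1}f)(x)$ exist for all $x\in U^\circ$ and $y_1,\dots,y_k\in E_1$, and define a continuous map $U^\circ\times E_1^k\to F$ that has a (necessarily unique) continuous extension $d^{(k)}f\colon U\times E_1^k\to F$. The vector space $C^r(U,F)$ of all $C^r$-maps carries the compact-open $C^r$-topology, the initial topology with respect to the maps $d^{(k)}\colon C^r(U,F)\to C(U\times E_1^k,F)$, $k\le r$, where spaces of continuous maps carry the compact-open topology; it is again a locally convex space. The space $C^s(V,F)$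 is defined in the same way. A map $f\colon U\times V\to F$ is called $C^{r,s}$ if it is continuous and, for all $i,j\in\mathbb{N}_0$ with $i\le r$ and $j\le s$, the iterated directional derivatives $$(D_{(w_i,0)}\cdots D_{(w_1,0)}D_{(0,v_j)}\cdots D_{(0,v_1)}f)(x,y)$$ exist for all $x\in U^\circ$, $y\in V^\circ$, $w_1,\dots,w_i\in E_1$, $v_1,\dots,v_j\in E_2$, and define a continuous map $U^\circ\times V^\circ\times E_1^i\times E_2^j\to F$ that has a (necessarily unique) continuous extension $d^{(i,j)}f\colon U\times V\times E_1^i\times E_2^j\to F$. The vector space $C^{r,s}(U\times V,F)$ of all $C^{r,s}$-maps carries the initial topology with respect to the maps $d^{(i,j)}\colon C^{r,s}(U\times V,F)\to C(U\times V\times E_1^i\times E_2^j,F)$, $i\le r$, $j\le s$, into spaces with the compact-open topology. Then the following holds. (a) If $\gamma\colon U\times V\to F$ is $C^{r,s}$, then $\gamma_x:=\gamma(x,\bullet)\colon V\to F$ is $C^s$ for each $x\in U$, and the map $\gamma^\vee\colon U\to C^s(V,F)$, $x\mapsto\gamma_x$, is $C^r$. (b) The map $$\Phi\colon C^{r,s}(U\times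 V,F)\to C^r(U,C^s(V,F)),\qquad \gamma\mapsto\gamma^\vee$$ is linear and a topological embedding. -/

import Mathlib

open Filter Topology

noncomputable section

section Derivatives

variable {E F : Type*} [AddCommGroup E] [Module ℝ E]
  [AddCommGroup F] [Module ℝ F] [TopologicalSpace F]

/-- `L` is the directional derivative `lim_{t → 0} t⁻¹ (f (x + t h) - f x)` of `f` at `x` in the
direction `h`. -/
def HasDirDeriv (f : E → F) (L : F) (x h : E) : Prop :=
  Tendsto (fun t : ℝ => t⁻¹ • (f (x + t • h) - f x)) (𝓝[≠] 0) (𝓝 L)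

/-- The directional derivative `D_h f`, as a function of the point (a junk value where it does not
exist). -/
def dirDeriv (f : E → F) (h : E) (x : E) : F :=
  limUnder (𝓝[≠] (0 : ℝ)) (fun t : ℝ => t⁻¹ • (f (x + t • h) - f x))

/-- The iterated directional derivative `D_{y_k} ⋯ D_{y_1} f` (with `y_{a+1}` written `y a`). -/
def iterDirDeriv (f : E → F) : (k : ℕ) → (Fin k → E) → E → F
  | 0, _ => f
  | k + 1, y => dirDeriv (iterDirDeriv f k (fun a => y a.castSucc)) (y (Fin.last k))

/-- The iterated directional derivative `D_{y_k} ⋯ D_{y_1} f` exists at all points of `O`: each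
of the functions `f`, `D_{y_1} f`, `D_{y_2} D_{y_1} f`, … has at each point of `O` a directional
derivative in the next direction. -/
def IterDirDiffOn (O : Set E) (f : E → F) : (k : ℕ) → (Fin k → E) → Prop
  | 0, _ => True
  | k + 1, y => IterDirDiffOn O f k (fun a => y a.castSucc) ∧
      ∀ x ∈ O, ∃ L, HasDirDeriv (iterDirDeriv f k (fun a => y a.castSucc)) L x (y (Fin.last k))

theorem HasDirDeriv.dirDeriv_eq [T2Space F] {f : E → F} {L : F} {x h : E}
    (H : HasDirDeriv f L x h) : dirDeriv f h x = L :=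
  Tendsto.limUnder_eq H

theorem HasDirDeriv.congr [TopologicalSpace E] [ContinuousAdd E] [ContinuousSMul ℝ E]
    {O : Set E} (hO : IsOpen O) {f g : E → F} (hfg : Set.EqOn f g O) {L : F} {x h : E}
    (hx : x ∈ O) (H : HasDirDeriv f L x h) : HasDirDeriv g L x h := by
  refine Tendsto.congr' ?_ H
  have hc : Tendsto (fun t : ℝ => x + t • h) (𝓝[≠] 0) (𝓝 x) := by
    have : Continuous (fun t : ℝ => x + t • h) := by fun_prop
    have h0 := this.tendsto 0
    simp only [zero_smul, add_zero] at h0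
    exact h0.mono_left nhdsWithin_le_nhds
  filter_upwards [hc.eventually (hO.mem_nhds hx)] with t ht
  rw [hfg ht, hfg hx]

theorem HasDirDeriv.add [ContinuousAdd F] {f g : E → F} {L M : F} {x h : E}
    (hf : HasDirDeriv f L x h) (hg : HasDirDeriv g M x h) : HasDirDeriv (f + g) (L + M) x h := by
  refine (Tendsto.add hf hg).congr fun t => ?_
  simp only [Pi.add_apply, ← smul_add]
  congr 1
  abel

theorem HasDirDeriv.const_smul [ContinuousConstSMul ℝ F] (c : ℝ) {f : E → F} {L : F} {x h : E}
    (hf : HasDirDeriv f L x h) : HasDirDeriv (c • f) (c • L) x h := by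
  refine (Tendsto.const_smul hf c).congr fun t => ?_
  simp only [Pi.smul_apply, ← smul_sub]
  rw [smul_comm]

variable [TopologicalSpace E] [ContinuousAdd E] [ContinuousSMul ℝ E] [T2Space F]

theorem iterDirDeriv_congr {O : Set E} (hO : IsOpen O) {f g : E → F} (hfg : Set.EqOn f g O)
    (k : ℕ) (y : Fin k → E) (hf : IterDirDiffOn O f k y) :
    IterDirDiffOn O g k y ∧ Set.EqOn (iterDirDeriv f k y) (iterDirDeriv g k y) O := by
  induction k with
  | zero => exact ⟨trivial, hfg⟩
  | succ k ih =>
    obtain ⟨h1, h2⟩ := ih _ hf.1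
    refine ⟨⟨h1, fun x hx => ?_⟩, fun x hx => ?_⟩
    · obtain ⟨L, hL⟩ := hf.2 x hx
      exact ⟨L, hL.congr hO h2 hx⟩
    · obtain ⟨L, hL⟩ := hf.2 x hx
      exact hL.dirDeriv_eq.trans (hL.congr hO h2 hx).dirDeriv_eq.symm

theorem iterDirDeriv_add [ContinuousAdd F] {O : Set E} (hO : IsOpen O) {f g : E → F}
    (k : ℕ) (y : Fin k → E) (hf : IterDirDiffOn O f k y) (hg : IterDirDiffOn O g k y) :
    IterDirDiffOn O (f + g) k y ∧
      Set.EqOn (iterDirDeriv f k y + iterDirDeriv g k y) (iterDirDeriv (f + g) k y) O := by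
  induction k with
  | zero => exact ⟨trivial, fun _ _ => rfl⟩
  | succ k ih =>
    obtain ⟨h1, h2⟩ := ih _ hf.1 hg.1
    refine ⟨⟨h1, fun x hx => ?_⟩, fun x hx => ?_⟩
    · obtain ⟨L, hL⟩ := hf.2 x hx
      obtain ⟨M, hM⟩ := hg.2 x hx
      exact ⟨L + M, (hL.add hM).congr hO h2 hx⟩
    · obtain ⟨L, hL⟩ := hf.2 x hx
      obtain ⟨M, hM⟩ := hg.2 x hx
      exact (congrArg₂ (· + ·) hL.dirDeriv_eq hM.dirDeriv_eq).trans
        ((hL.add hM).congr hO h2 hx).dirDeriv_eq.symm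

theorem iterDirDeriv_const_smul [ContinuousConstSMul ℝ F] {O : Set E} (hO : IsOpen O) (c : ℝ)
    {f : E → F} (k : ℕ) (y : Fin k → E) (hf : IterDirDiffOn O f k y) :
    IterDirDiffOn O (c • f) k y ∧
      Set.EqOn (c • iterDirDeriv f k y) (iterDirDeriv (c • f) k y) O := by
  induction k with
  | zero => exact ⟨trivial, fun _ _ => rfl⟩
  | succ k ih =>
    obtain ⟨h1, h2⟩ := ih _ hf.1
    refine ⟨⟨h1, fun x hx => ?_⟩, fun x hx => ?_⟩
    · obtain ⟨L, hL⟩ := hf.2 x hx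
      exact ⟨c • L, (hL.const_smul c).congr hO h2 hx⟩
    · obtain ⟨L, hL⟩ := hf.2 x hx
      exact (congrArg (c • ·) hL.dirDeriv_eq).trans
        ((hL.const_smul c).congr hO h2 hx).dirDeriv_eq.symm

end Derivatives

section Zero

variable {E F : Type*} [AddCommGroup E] [Module ℝ E]
  [AddCommGroup F] [Module ℝ F] [TopologicalSpace F] [T2Space F]

theorem iterDirDeriv_zero (k : ℕ) (y : Fin k → E) : iterDirDeriv (0 : E → F) k y = 0 := by
  induction k with
  | zero => rfl
  | succ k ih =>
    funext x
    refine HasDirDeriv.dirDeriv_eq ?_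
    rw [ih]
    simpa [HasDirDeriv] using tendsto_const_nhds

theorem iterDirDiffOn_zero (O : Set E) (k : ℕ) (y : Fin k → E) :
    IterDirDiffOn O (0 : E → F) k y := by
  induction k with
  | zero => trivial
  | succ k ih =>
    refine ⟨ih _, fun x _ => ⟨0, ?_⟩⟩
    rw [iterDirDeriv_zero]
    simpa [HasDirDeriv] using tendsto_const_nhds

end Zero

/-- A locally convex subset with dense interior of a topological vector space: each point has a
convex neighbourhood in the set, and the interior of the set is dense in it. -/
structure LCDomain (E : Type*) [AddCommGroup E] [Module ℝ E] [TopologicalSpace E] where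
  carrier : Set E
  locallyConvex : ∀ x ∈ carrier, ∃ W ∈ 𝓝[carrier] x, W ⊆ carrier ∧ Convex ℝ W
  dense_interior : carrier ⊆ closure (interior carrier)

instance {E : Type*} [AddCommGroup E] [Module ℝ E] [TopologicalSpace E] :
    CoeSort (LCDomain E) (Type _) := ⟨fun U => ↥U.carrier⟩

section Cr

variable {E F : Type*} [AddCommGroup E] [Module ℝ E] [TopologicalSpace E]
  [AddCommGroup F] [Module ℝ F] [TopologicalSpace F]

/-- Extension by zero of a function on `U` to the whole space. It is only differentiated at interior
points of `U`, where the values outside `U` play no role. -/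
def extZero {U : LCDomain E} (f : U → F) : E → F := Function.extend Subtype.val f 0

/-- `g` is a continuous extension to `U × E^k` of the iterated differential
`d^{(k)} (f|_{U°}) : U° × E^k → F`, `(x, y_1, …, y_k) ↦ (D_{y_k} ⋯ D_{y_1} f) (x)`. -/
def IsDiffExt {U : LCDomain E} (f : U → F) (k : ℕ) (g : C(U × (Fin k → E), F)) : Prop :=
  ∀ x : U, (x : E) ∈ interior U.carrier → ∀ y : Fin k → E,
    g (x, y) = iterDirDeriv (extZero f) k y x

/-- `f : U → F` is `C^r`: it is continuous, on the interior of `U` all iterated directional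
derivatives of order `k ≤ r` exist, and the resulting maps `U° × E^k → F` are continuous and
extend continuously to `U × E^k`. -/
def IsCr (r : ℕ∞) {U : LCDomain E} (f : U → F) : Prop :=
  Continuous f ∧ ∀ k : ℕ, (k : ℕ∞) ≤ r →
    (∀ y : Fin k → E, IterDirDiffOn (interior U.carrier) (extZero f) k y) ∧
    ∃ g : C(U × (Fin k → E), F), IsDiffExt f k g

/-- The differential `d^{(k)} f : U × E^k → F` of a `C^r`-map, `k ≤ r`: the (unique) continuous
extension of `d^{(k)} (f|_{U°})`. -/
def IsCr.diff {r : ℕ∞} {U : LCDomain E} {f : U → F} (hf : IsCr r f) (k : ℕ)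
    (hk : (k : ℕ∞) ≤ r) : C(U × (Fin k → E), F) :=
  (hf.2 k hk).2.choose

theorem IsCr.diff_spec {r : ℕ∞} {U : LCDomain E} {f : U → F} (hf : IsCr r f) (k : ℕ)
    (hk : (k : ℕ∞) ≤ r) : IsDiffExt f k (hf.diff k hk) :=
  (hf.2 k hk).2.choose_spec

theorem extZero_apply {U : LCDomain E} (f : U → F) (x : U) : extZero f x = f x :=
  Subtype.val_injective.extend_apply f 0 x

theorem extZero_zero {U : LCDomain E} : extZero (0 : U → F) = 0 := by
  classical
  funext x
  by_cases h : ∃ a : U, a.1 = x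
  · obtain ⟨a, rfl⟩ := h
    exact extZero_apply _ a
  · simp [extZero, Function.extend_apply' _ _ _ h]

theorem extZero_add {U : LCDomain E} (f g : U → F) :
    extZero (f + g) = extZero f + extZero g := by
  funext x
  by_cases h : ∃ a : U, a.1 = x
  · obtain ⟨a, rfl⟩ := h
    simp [extZero_apply]
  · simp [extZero, Function.extend_apply' _ _ _ h]

theorem extZero_smul {U : LCDomain E} (c : ℝ) (f : U → F) :
    extZero (c • f) = c • extZero f := by
  funext x
  by_cases h : ∃ a : U, a.1 = x
  · obtain ⟨a, rfl⟩ := h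
    simp [extZero_apply]
  · simp [extZero, Function.extend_apply' _ _ _ h]

theorem LCDomain.dense (U : LCDomain E) : Dense {x : U | (x : E) ∈ interior U.carrier} := by
  intro x
  rw [closure_subtype]
  refine closure_mono ?_ (U.dense_interior x.2)
  intro z hz
  exact ⟨⟨z, interior_subset hz⟩, hz, rfl⟩

theorem IsDiffExt.unique [T2Space F] {U : LCDomain E} {f : U → F} {k : ℕ}
    {g h : C(U × (Fin k → E), F)} (hg : IsDiffExt f k g) (hh : IsDiffExt f k h) : g = h := by
  have hd : Dense ({x : U | (x : E) ∈ interior U.carrier} ×ˢ (Set.univ : Set (Fin k → E))) :=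
    U.dense.prod dense_univ
  refine ContinuousMap.ext fun p => congrFun (g.continuous.ext_on hd h.continuous ?_) p
  rintro ⟨x, y⟩ hx
  exact (hg x hx.1 y).trans (hh x hx.1 y).symm

theorem IsDiffExt.diff_eq [T2Space F] {r : ℕ∞} {U : LCDomain E} {f : U → F} (hf : IsCr r f)
    {k : ℕ} (hk : (k : ℕ∞) ≤ r) {g : C(U × (Fin k → E), F)} (hg : IsDiffExt f k g) :
    hf.diff k hk = g :=
  (hf.diff_spec k hk).unique hg

variable [IsTopologicalAddGroup E] [ContinuousSMul ℝ E]
  [IsTopologicalAddGroup F] [ContinuousSMul ℝ F] [T2Space F]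

theorem IsDiffExt.add {r : ℕ∞} {U : LCDomain E} {f₁ f₂ : U → F} (h₁ : IsCr r f₁)
    (h₂ : IsCr r f₂) {k : ℕ} (hk : (k : ℕ∞) ≤ r) {g₁ g₂ : C(U × (Fin k → E), F)}
    (hg₁ : IsDiffExt f₁ k g₁) (hg₂ : IsDiffExt f₂ k g₂) : IsDiffExt (f₁ + f₂) k (g₁ + g₂) := by
  intro x hx y
  rw [extZero_add, ContinuousMap.add_apply, hg₁ x hx y, hg₂ x hx y]
  exact (iterDirDeriv_add isOpen_interior k y ((h₁.2 k hk).1 y) ((h₂.2 k hk).1 y)).2 hx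

theorem IsDiffExt.smul {r : ℕ∞} {U : LCDomain E} (c : ℝ) {f : U → F} (h : IsCr r f)
    {k : ℕ} (hk : (k : ℕ∞) ≤ r) {g : C(U × (Fin k → E), F)}
    (hg : IsDiffExt f k g) : IsDiffExt (c • f) k (c • g) := by
  intro x hx y
  rw [extZero_smul, ContinuousMap.smul_apply, hg x hx y]
  exact (iterDirDeriv_const_smul isOpen_interior c k y ((h.2 k hk).1 y)).2 hx

theorem IsCr.zero (r : ℕ∞) (U : LCDomain E) : IsCr r (0 : U → F) := by
  refine ⟨continuous_const, fun k _ => ⟨fun y => ?_, 0, fun x _ y => ?_⟩⟩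
  · rw [extZero_zero]
    exact iterDirDiffOn_zero _ k y
  · rw [extZero_zero, iterDirDeriv_zero]
    rfl

theorem IsCr.add {r : ℕ∞} {U : LCDomain E} {f₁ f₂ : U → F} (h₁ : IsCr r f₁)
    (h₂ : IsCr r f₂) : IsCr r (f₁ + f₂) := by
  refine ⟨h₁.1.add h₂.1, fun k hk => ⟨fun y => ?_, _,
    IsDiffExt.add h₁ h₂ hk (h₁.diff_spec k hk) (h₂.diff_spec k hk)⟩⟩
  rw [extZero_add]
  exact (iterDirDeriv_add isOpen_interior k y ((h₁.2 k hk).1 y) ((h₂.2 k hk).1 y)).1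

theorem IsCr.smul {r : ℕ∞} {U : LCDomain E} (c : ℝ) {f : U → F} (h : IsCr r f) :
    IsCr r (c • f) := by
  refine ⟨h.1.const_smul c, fun k hk => ⟨fun y => ?_, _,
    IsDiffExt.smul c h hk (h.diff_spec k hk)⟩⟩
  rw [extZero_smul]
  exact (iterDirDeriv_const_smul isOpen_interior c k y ((h.2 k hk).1 y)).1

/-- The `C^r`-maps form a linear subspace of the space of all maps `U → F`. -/
def crSubmodule (r : ℕ∞) (U : LCDomain E) (F : Type*) [AddCommGroup F] [Module ℝ F]
    [TopologicalSpace F] [IsTopologicalAddGroup F] [ContinuousSMul ℝ F] [T2Space F] :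
    Submodule ℝ (U → F) where
  carrier := {f | IsCr r f}
  add_mem' h₁ h₂ := IsCr.add h₁ h₂
  zero_mem' := IsCr.zero r U
  smul_mem' c _ h := IsCr.smul c h

/-- The space `C^r(U, F)` (a type of its own, because it does not carry the topology of pointwise
convergence). -/
def CrMap (r : ℕ∞) (U : LCDomain E) (F : Type*) [AddCommGroup F] [Module ℝ F]
    [TopologicalSpace F] [IsTopologicalAddGroup F] [ContinuousSMul ℝ F] [T2Space F] : Type _ :=
  ↥(crSubmodule r U F)

namespace CrMap

variable {r : ℕ∞} {U : LCDomain E}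

instance : AddCommGroup (CrMap r U F) := inferInstanceAs (AddCommGroup ↥(crSubmodule r U F))

instance : Module ℝ (CrMap r U F) := inferInstanceAs (Module ℝ ↥(crSubmodule r U F))

instance : CoeFun (CrMap r U F) (fun _ => U → F) := ⟨fun f => f.1⟩

/-- A `C^r`-map as an element of `C^r(U, F)`. -/
def mk (f : U → F) (hf : IsCr r f) : CrMap r U F := ⟨f, hf⟩

theorem isCr (f : CrMap r U F) : IsCr r (f : U → F) := f.2

/-- The linear map `d^{(k)} : C^r(U, F) → C(U × E^k, F)`, `k ≤ r`. -/
def diff (k : ℕ) (hk : (k : ℕ∞) ≤ r) : CrMap r U F →ₗ[ℝ] C(U × (Fin k → E), F) where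
  toFun f := f.isCr.diff k hk
  map_add' f g := IsDiffExt.diff_eq (f + g).isCr hk
    (IsDiffExt.add f.isCr g.isCr hk (f.isCr.diff_spec k hk) (g.isCr.diff_spec k hk))
  map_smul' c f := IsDiffExt.diff_eq (c • f).isCr hk
    (IsDiffExt.smul c f.isCr hk (f.isCr.diff_spec k hk))

/-- The compact-open `C^r`-topology: the initial topology with respect to the maps `d^{(k)}`,
`k ≤ r`, into the spaces `C(U × E^k, F)` with the compact-open topology. -/
instance : TopologicalSpace (CrMap r U F) :=
  ⨅ (k : ℕ) (hk : (k : ℕ∞) ≤ r),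
    TopologicalSpace.induced (fun f : CrMap r U F => f.isCr.diff k hk) ContinuousMap.compactOpen

instance : IsTopologicalAddGroup (CrMap r U F) :=
  topologicalAddGroup_iInf fun k => topologicalAddGroup_iInf fun hk =>
    topologicalAddGroup_induced (diff (F := F) (U := U) k hk)

instance : ContinuousSMul ℝ (CrMap r U F) :=
  continuousSMul_iInf fun k => continuousSMul_iInf fun hk =>
    continuousSMul_induced (diff (F := F) (U := U) k hk)

instance [LocallyConvexSpace ℝ F] : LocallyConvexSpace ℝ (CrMap r U F) :=
  LocallyConvexSpace.iInf fun k => LocallyConvexSpace.iInf fun hk =>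
    LocallyConvexSpace.induced (diff (F := F) (U := U) k hk)

theorem continuous_diff (k : ℕ) (hk : (k : ℕ∞) ≤ r) :
    Continuous (diff (F := F) (U := U) k hk) :=
  continuous_iInf_dom (i := k) (continuous_iInf_dom (i := hk) continuous_induced_dom)

theorem diff_zero_apply (f : CrMap r U F) (h0 : ((0 : ℕ) : ℕ∞) ≤ r) (x : U)
    (y : Fin 0 → E) : diff 0 h0 f (x, y) = f x := by
  let g : C(U × (Fin 0 → E), F) := ⟨fun p => f p.1, f.isCr.1.comp continuous_fst⟩
  have hg : IsDiffExt (f : U → F) 0 g := fun x _ y => (extZero_apply _ x).symm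
  exact congrArg (fun q : C(U × (Fin 0 → E), F) => q (x, y)) (IsDiffExt.diff_eq f.isCr h0 hg)

instance : T2Space (CrMap r U F) := by
  refine T2Space.of_injective_continuous (f := diff (F := F) (U := U) 0 (by simp)) ?_
    (continuous_diff 0 _)
  intro f g hfg
  refine Subtype.ext (funext fun x => ?_)
  have := congrArg (fun q : C(U × (Fin 0 → E), F) => q (x, 0)) hfg
  simpa only [diff_zero_apply] using this

end CrMap

end Cr

section Crs

variable {E₁ E₂ F : Type*} [AddCommGroup E₁] [Module ℝ E₁] [TopologicalSpace E₁]
  [AddCommGroup E₂] [Module ℝ E₂] [TopologicalSpace E₂]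
  [AddCommGroup F] [Module ℝ F] [TopologicalSpace F]

/-- Extension by zero of a function on `U × V`. It is only differentiated at points of `U° × V°`,
where the values outside `U × V` play no role. -/
def extZero₂ {U : LCDomain E₁} {V : LCDomain E₂} (f : U × V → F) : E₁ × E₂ → F :=
  Function.extend (Prod.map Subtype.val Subtype.val) f 0

/-- The set `U° × V°`. -/
def interior₂ (U : LCDomain E₁) (V : LCDomain E₂) : Set (E₁ × E₂) :=
  interior U.carrier ×ˢ interior V.carrier

/-- The derivative `D_{(0,v_j)} ⋯ D_{(0,v_1)} f` in the second variable. -/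
def iterDirDerivSnd (f : E₁ × E₂ → F) (j : ℕ) (v : Fin j → E₂) : E₁ × E₂ → F :=
  iterDirDeriv f j (fun a => ((0 : E₁), v a))

/-- The derivative `D_{(w_i,0)} ⋯ D_{(w_1,0)} D_{(0,v_j)} ⋯ D_{(0,v_1)} f`. -/
def iterDirDeriv₂ (f : E₁ × E₂ → F) (i j : ℕ) (w : Fin i → E₁) (v : Fin j → E₂) :
    E₁ × E₂ → F :=
  iterDirDeriv (iterDirDerivSnd f j v) i (fun a => (w a, (0 : E₂)))

/-- `D_{(w_i,0)} ⋯ D_{(w_1,0)} D_{(0,v_j)} ⋯ D_{(0,v_1)} f` exists at all points of `O`. -/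
def IterDirDiffOn₂ (O : Set (E₁ × E₂)) (f : E₁ × E₂ → F) (i j : ℕ) (w : Fin i → E₁)
    (v : Fin j → E₂) : Prop :=
  IterDirDiffOn O f j (fun a => ((0 : E₁), v a)) ∧
    IterDirDiffOn O (iterDirDerivSnd f j v) i (fun a => (w a, (0 : E₂)))

/-- `g` is a continuous extension to `U × V × E₁^i × E₂^j` of the map
`d^{(i,j)} (f|_{U° × V°}) : U° × V° × E₁^i × E₂^j → F`. -/
def IsDiffExt₂ {U : LCDomain E₁} {V : LCDomain E₂} (f : U × V → F) (i j : ℕ)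
    (g : C(U × V × (Fin i → E₁) × (Fin j → E₂), F)) : Prop :=
  ∀ (x : U) (y : V), (x : E₁) ∈ interior U.carrier → (y : E₂) ∈ interior V.carrier →
    ∀ (w : Fin i → E₁) (v : Fin j → E₂),
      g (x, y, w, v) = iterDirDeriv₂ (extZero₂ f) i j w v (x, y)

/-- `f : U × V → F` is `C^{r,s}`: it is continuous, on `U° × V°` the iterated directional
derivatives `D_{(w_i,0)} ⋯ D_{(w_1,0)} D_{(0,v_j)} ⋯ D_{(0,v_1)} f` exist for `i ≤ r`, `j ≤ s`,
and the resulting maps `U° × V° × E₁^i × E₂^j → F` are continuous and extend continuously to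
`U × V × E₁^i × E₂^j`. -/
def IsCrs (r s : ℕ∞) {U : LCDomain E₁} {V : LCDomain E₂} (f : U × V → F) : Prop :=
  Continuous f ∧ ∀ i j : ℕ, (i : ℕ∞) ≤ r → (j : ℕ∞) ≤ s →
    (∀ (w : Fin i → E₁) (v : Fin j → E₂),
      IterDirDiffOn₂ (interior₂ U V) (extZero₂ f) i j w v) ∧
    ∃ g : C(U × V × (Fin i → E₁) × (Fin j → E₂), F), IsDiffExt₂ f i j g

/-- The map `d^{(i,j)} f : U × V × E₁^i × E₂^j → F` of a `C^{r,s}`-map: the (unique) continuous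
extension of `d^{(i,j)} (f|_{U° × V°})`. -/
def IsCrs.diff {r s : ℕ∞} {U : LCDomain E₁} {V : LCDomain E₂} {f : U × V → F}
    (hf : IsCrs r s f) (i j : ℕ) (hi : (i : ℕ∞) ≤ r) (hj : (j : ℕ∞) ≤ s) :
    C(U × V × (Fin i → E₁) × (Fin j → E₂), F) :=
  (hf.2 i j hi hj).2.choose

theorem extZero₂_apply {U : LCDomain E₁} {V : LCDomain E₂} (f : U × V → F) (x : U) (y : V) :
    extZero₂ f (x, y) = f (x, y) :=
  (Subtype.val_injective.prodMap Subtype.val_injective).extend_apply f 0 (x, y)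

theorem extZero₂_of_not {U : LCDomain E₁} {V : LCDomain E₂} (f : U × V → F) {p : E₁ × E₂}
    (h : ¬ ∃ a : U × V, Prod.map Subtype.val Subtype.val a = p) : extZero₂ f p = 0 := by
  rw [extZero₂, Function.extend_apply' _ _ _ h]
  rfl

theorem extZero₂_zero {U : LCDomain E₁} {V : LCDomain E₂} : extZero₂ (0 : U × V → F) = 0 := by
  funext x
  by_cases h : ∃ a : U × V, Prod.map Subtype.val Subtype.val a = x
  · obtain ⟨⟨a, b⟩, rfl⟩ := h
    exact extZero₂_apply _ a b
  · exact extZero₂_of_not _ h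

theorem extZero₂_add {U : LCDomain E₁} {V : LCDomain E₂} (f g : U × V → F) :
    extZero₂ (f + g) = extZero₂ f + extZero₂ g := by
  funext x
  by_cases h : ∃ a : U × V, Prod.map Subtype.val Subtype.val a = x
  · obtain ⟨⟨a, b⟩, rfl⟩ := h
    simp [extZero₂_apply]
  · simp [extZero₂_of_not _ h]

theorem extZero₂_smul {U : LCDomain E₁} {V : LCDomain E₂} (c : ℝ) (f : U × V → F) :
    extZero₂ (c • f) = c • extZero₂ f := by
  funext x
  by_cases h : ∃ a : U × V, Prod.map Subtype.val Subtype.val a = x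
  · obtain ⟨⟨a, b⟩, rfl⟩ := h
    simp [extZero₂_apply]
  · simp [extZero₂_of_not _ h]

theorem isOpen_interior₂ (U : LCDomain E₁) (V : LCDomain E₂) : IsOpen (interior₂ U V) :=
  isOpen_interior.prod isOpen_interior

variable [IsTopologicalAddGroup E₁] [ContinuousSMul ℝ E₁]
  [IsTopologicalAddGroup E₂] [ContinuousSMul ℝ E₂]
  [IsTopologicalAddGroup F] [ContinuousSMul ℝ F] [T2Space F]

theorem iterDirDeriv₂_add {O : Set (E₁ × E₂)} (hO : IsOpen O) {f g : E₁ × E₂ → F} (i j : ℕ)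
    (w : Fin i → E₁) (v : Fin j → E₂) (hf : IterDirDiffOn₂ O f i j w v)
    (hg : IterDirDiffOn₂ O g i j w v) :
    IterDirDiffOn₂ O (f + g) i j w v ∧
      Set.EqOn (iterDirDeriv₂ f i j w v + iterDirDeriv₂ g i j w v)
        (iterDirDeriv₂ (f + g) i j w v) O := by
  obtain ⟨h1, h2⟩ := iterDirDeriv_add hO j _ hf.1 hg.1
  obtain ⟨h3, h4⟩ := iterDirDeriv_add hO i _ hf.2 hg.2
  obtain ⟨h5, h6⟩ := iterDirDeriv_congr hO h2 i _ h3
  exact ⟨⟨h1, h5⟩, h4.trans h6⟩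

theorem iterDirDeriv₂_const_smul {O : Set (E₁ × E₂)} (hO : IsOpen O) (c : ℝ) {f : E₁ × E₂ → F}
    (i j : ℕ) (w : Fin i → E₁) (v : Fin j → E₂) (hf : IterDirDiffOn₂ O f i j w v) :
    IterDirDiffOn₂ O (c • f) i j w v ∧
      Set.EqOn (c • iterDirDeriv₂ f i j w v) (iterDirDeriv₂ (c • f) i j w v) O := by
  obtain ⟨h1, h2⟩ := iterDirDeriv_const_smul hO c j _ hf.1
  obtain ⟨h3, h4⟩ := iterDirDeriv_const_smul hO c i _ hf.2
  obtain ⟨h5, h6⟩ := iterDirDeriv_congr hO h2 i _ h3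
  exact ⟨⟨h1, h5⟩, h4.trans h6⟩

theorem IsCrs.zero (r s : ℕ∞) (U : LCDomain E₁) (V : LCDomain E₂) :
    IsCrs r s (0 : U × V → F) := by
  refine ⟨continuous_const, fun i j _ _ => ⟨fun w v => ?_, 0, fun x y _ _ w v => ?_⟩⟩
  · rw [extZero₂_zero, IterDirDiffOn₂, iterDirDerivSnd, iterDirDeriv_zero]
    exact ⟨iterDirDiffOn_zero _ j _, iterDirDiffOn_zero _ i _⟩
  · rw [extZero₂_zero, iterDirDeriv₂, iterDirDerivSnd, iterDirDeriv_zero, iterDirDeriv_zero]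
    rfl

theorem IsCrs.add {r s : ℕ∞} {U : LCDomain E₁} {V : LCDomain E₂} {f₁ f₂ : U × V → F}
    (h₁ : IsCrs r s f₁) (h₂ : IsCrs r s f₂) : IsCrs r s (f₁ + f₂) := by
  refine ⟨h₁.1.add h₂.1, fun i j hi hj => ?_⟩
  obtain ⟨e₁, g₁, hg₁⟩ := h₁.2 i j hi hj
  obtain ⟨e₂, g₂, hg₂⟩ := h₂.2 i j hi hj
  have key := fun w v => iterDirDeriv₂_add (isOpen_interior₂ U V) i j w v (e₁ w v) (e₂ w v)
  refine ⟨fun w v => ?_, g₁ + g₂, fun x y hx hy w v => ?_⟩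
  · rw [extZero₂_add]
    exact (key w v).1
  · rw [extZero₂_add, ContinuousMap.add_apply, hg₁ x y hx hy, hg₂ x y hx hy]
    exact (key w v).2 ⟨hx, hy⟩

theorem IsCrs.smul {r s : ℕ∞} {U : LCDomain E₁} {V : LCDomain E₂} (c : ℝ) {f : U × V → F}
    (h : IsCrs r s f) : IsCrs r s (c • f) := by
  refine ⟨h.1.const_smul c, fun i j hi hj => ?_⟩
  obtain ⟨e, g, hg⟩ := h.2 i j hi hj
  have key := fun w v => iterDirDeriv₂_const_smul (isOpen_interior₂ U V) c i j w v (e w v)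
  refine ⟨fun w v => ?_, c • g, fun x y hx hy w v => ?_⟩
  · rw [extZero₂_smul]
    exact (key w v).1
  · rw [extZero₂_smul, ContinuousMap.smul_apply, hg x y hx hy]
    exact (key w v).2 ⟨hx, hy⟩

/-- The `C^{r,s}`-maps form a linear subspace of the space of all maps `U × V → F`. -/
def crsSubmodule (r s : ℕ∞) (U : LCDomain E₁) (V : LCDomain E₂) (F : Type*) [AddCommGroup F]
    [Module ℝ F] [TopologicalSpace F] [IsTopologicalAddGroup F] [ContinuousSMul ℝ F]
    [T2Space F] : Submodule ℝ (U × V → F) where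
  carrier := {f | IsCrs r s f}
  add_mem' h₁ h₂ := IsCrs.add h₁ h₂
  zero_mem' := IsCrs.zero r s U V
  smul_mem' c _ h := IsCrs.smul c h

/-- The space `C^{r,s}(U × V, F)`. -/
def CrsMap (r s : ℕ∞) (U : LCDomain E₁) (V : LCDomain E₂) (F : Type*) [AddCommGroup F]
    [Module ℝ F] [TopologicalSpace F] [IsTopologicalAddGroup F] [ContinuousSMul ℝ F]
    [T2Space F] : Type _ :=
  ↥(crsSubmodule r s U V F)

namespace CrsMap

variable {r s : ℕ∞} {U : LCDomain E₁} {V : LCDomain E₂}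

instance : AddCommGroup (CrsMap r s U V F) :=
  inferInstanceAs (AddCommGroup ↥(crsSubmodule r s U V F))

instance : Module ℝ (CrsMap r s U V F) := inferInstanceAs (Module ℝ ↥(crsSubmodule r s U V F))

instance : CoeFun (CrsMap r s U V F) (fun _ => U × V → F) := ⟨fun f => f.1⟩

theorem isCrs (f : CrsMap r s U V F) : IsCrs r s (f : U × V → F) := f.2

/-- The compact-open `C^{r,s}`-topology: the initial topology with respect to the maps `d^{(i,j)}`,
`i ≤ r`, `j ≤ s`, into the spaces `C(U × V × E₁^i × E₂^j, F)` with the compact-open topology. -/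
instance : TopologicalSpace (CrsMap r s U V F) :=
  ⨅ (i : ℕ) (j : ℕ) (hi : (i : ℕ∞) ≤ r) (hj : (j : ℕ∞) ≤ s),
    TopologicalSpace.induced (fun f : CrsMap r s U V F => f.isCrs.diff i j hi hj)
      ContinuousMap.compactOpen

end CrsMap

end Crs

end

/-! Everything rests on one mean value principle in a locally convex space: by Hahn-Banach, a
difference quotient lies in every closed convex set containing the derivatives along the segment. So
if the derivatives of a family of curves converge, the difference quotients converge to the same
limit (`tendsto_slope_of_tendsto_deriv`), and the derivative passes to a pointwise limit curve
(`hasDirDeriv_zero_of_tendsto`).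

This is used three times. It gives a Schwarz theorem, so that a further derivative in the second
variable can be taken after those in the first (`IsCrs.hasDirDeriv_snd`). It extends the derivative
relations between the maps `d^{(i,j)} γ` to points where the variable that is held fixed lies on the
boundary of its domain. Finally, with the family indexed by a compact set, it makes the difference
quotients in `x` converge uniformly on compact sets together with their `y`-derivatives, that is, in
`C^s(V, F)` (`IsCrs.hasDirDeriv_slice`). Hence `d^{(i)} γ^∨ (x, w)` is the map `y ↦ d^{(i,0)} γ (x,
y, w)`.

Consequently `d^{(j)} (d^{(i)} γ^∨ (x, w)) (y, v) = d^{(i,j)} γ (x, y, w, v)`. Both topologies then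
express uniform convergence of the same functions, on products of compact sets or on arbitrary
compact sets; these agree because a compact set lies in the product of its projections. -/

/-! ### Mean value theorem and limits of families of curves -/

section MeanValue

variable {F : Type*} [AddCommGroup F] [Module ℝ F] [TopologicalSpace F]
  [IsTopologicalAddGroup F] [ContinuousSMul ℝ F] [LocallyConvexSpace ℝ F]

theorem exists_closed_convex_mem_nhds_subset {x : F} {S : Set F} (hS : S ∈ 𝓝 x) :
    ∃ C ∈ 𝓝 x, IsClosed C ∧ Convex ℝ C ∧ C ⊆ S := by
  obtain ⟨T, hT, hTc, hTS⟩ := exists_mem_nhds_isClosed_subset hS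
  obtain ⟨C, ⟨hC, hCc⟩, hCT⟩ := (LocallyConvexSpace.convex_basis (𝕜 := ℝ) x).mem_iff.1 hT
  exact ⟨closure C, mem_of_superset hC subset_closure, isClosed_closure, hCc.closure,
    (closure_minimal hCT hTc).trans hTS⟩

/-- Mean value theorem: a difference quotient lies in each closed convex set that contains the
derivatives. -/
theorem slope_mem_of_hasDirDeriv {f f' : ℝ → F} {C : Set F} (hC : IsClosed C)
    (hconv : Convex ℝ C) {t : ℝ} (ht : t ≠ 0)
    (hf : ∀ u ∈ Set.Icc (0 : ℝ) 1, HasDirDeriv f (f' (u * t)) (u * t) 1 ∧ f' (u * t) ∈ C) :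
    t⁻¹ • (f t - f 0) ∈ C := by
  by_contra hn
  -- The functional `φ` stays below `a` on `C` and exceeds `a` at the quotient; the real mean value
  -- theorem for `φ ∘ f` contradicts this. Parametrizing by `u * t` with `u ∈ [0, 1]` treats both
  -- signs of `t` at once.
  obtain ⟨φ, a, hφ, ha⟩ := geometric_hahn_banach_closed_point hconv hC hn
  have hd : ∀ u ∈ Set.Icc (0 : ℝ) 1, HasDerivAt (fun u => φ (f (u * t))) (φ (f' (u * t)) * t) u := by
    intro u hu
    have h1 : HasDerivAt (fun τ => φ (f τ)) (φ (f' (u * t))) (u * t) := by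
      rw [hasDerivAt_iff_tendsto_slope_zero]
      refine ((φ.continuous.tendsto _).comp (hf u hu).1).congr fun τ => ?_
      simp
    exact h1.comp u (by simpa using (hasDerivAt_id u).mul_const t)
  obtain ⟨c, hc, he⟩ := exists_hasDerivAt_eq_slope (fun u => φ (f (u * t)))
    (fun u => φ (f' (u * t)) * t) zero_lt_one
    (fun u hu => (hd u hu).continuousAt.continuousWithinAt)
    (fun u hu => hd u (Set.Ioo_subset_Icc_self hu))
  have h2 := hφ _ (hf c (Set.Ioo_subset_Icc_self hc)).2
  simp only [one_mul, zero_mul, sub_zero, div_one] at he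
  have h3 : φ (f' (c * t)) = φ (t⁻¹ • (f t - f 0)) := by
    rw [map_smul, map_sub, ← he, smul_eq_mul]
    field_simp
  linarith

/-- If the derivatives of a family of curves converge, then so do the difference quotients. -/
theorem tendsto_slope_of_tendsto_deriv {β : Type*} {l : Filter β} {f f' : β → ℝ → F} {L : F}
    (hf : ∀ᶠ p : β × ℝ in l ×ˢ 𝓝 0, HasDirDeriv (f p.1) (f' p.1 p.2) p.2 1)
    (hL : Tendsto (fun p : β × ℝ => f' p.1 p.2) (l ×ˢ 𝓝 0) (𝓝 L)) :
    Tendsto (fun p : β × ℝ => p.2⁻¹ • (f p.1 p.2 - f p.1 0)) (l ×ˢ 𝓝[≠] 0) (𝓝 L) := by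
  intro S hS
  obtain ⟨C, hC, hCc, hCv, hCS⟩ := exists_closed_convex_mem_nhds_subset hS
  have hev := hf.and (hL hC)
  rw [eventually_prod_iff] at hev
  obtain ⟨pa, ha, pb, hb, hab⟩ := hev
  obtain ⟨δ, hδ, hball⟩ := Metric.eventually_nhds_iff.1 hb
  have h1 : ∀ᶠ t : ℝ in 𝓝[≠] 0, t ≠ 0 ∧ dist t 0 < δ :=
    (eventually_mem_nhdsWithin (a := (0 : ℝ)) (s := {0}ᶜ)).and ((Metric.eventually_nhds_iff.2 ⟨δ, hδ, fun _ h => h⟩).filter_mono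
      nhdsWithin_le_nhds)
  refine (ha.prod_mk h1).mono ?_
  rintro ⟨b, t⟩ ⟨hba, ht0, htδ⟩
  refine hCS (slope_mem_of_hasDirDeriv (f' := f' b) hCc hCv ht0 fun u hu => hab hba (hball ?_))
  rw [dist_zero_right, norm_mul, Real.norm_of_nonneg hu.1]
  rw [dist_zero_right] at htδ
  nlinarith [hu.2, norm_nonneg t]

/-- If the derivatives of a family of curves converge and the curves converge pointwise, then the
limit curve is differentiable. -/
theorem hasDirDeriv_zero_of_tendsto {β : Type*} {l : Filter β} [l.NeBot] {f f' : β → ℝ → F}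
    {f₀ : ℝ → F} {L : F}
    (hf : ∀ᶠ p : β × ℝ in l ×ˢ 𝓝 0, HasDirDeriv (f p.1) (f' p.1 p.2) p.2 1)
    (hL : Tendsto (fun p : β × ℝ => f' p.1 p.2) (l ×ˢ 𝓝 0) (𝓝 L))
    (h₀ : ∀ᶠ t in 𝓝 0, Tendsto (fun b => f b t) l (𝓝 (f₀ t))) : HasDirDeriv f₀ L 0 1 := by
  intro S hS
  obtain ⟨C, hC, hCc, -, hCS⟩ := exists_closed_convex_mem_nhds_subset hS
  -- For each small `t ≠ 0` the quotients lie in `C` eventually in `b`; as `C` is closed, the limit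
  -- over `b` stays in `C`.
  have h1 := (eventually_swap_iff.1 (tendsto_slope_of_tendsto_deriv hf hL hC)).curry
  rw [mem_map]
  filter_upwards [h1, h₀.filter_mono nhdsWithin_le_nhds] with t ht h0t
  simp only [zero_add, smul_eq_mul, mul_one]
  exact hCS (hCc.mem_of_tendsto ((h0t.sub h₀.self_of_nhds).const_smul t⁻¹) ht)

end MeanValue

/-! ### Boundary points, Schwarz' theorem and iterated derivatives -/

section Directional

variable {E F : Type*} [AddCommGroup E] [Module ℝ E]
  [AddCommGroup F] [Module ℝ F] [TopologicalSpace F]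

theorem HasDirDeriv.comp_line {f : E → F} {L : F} {x h : E} {t : ℝ}
    (H : HasDirDeriv f L (x + t • h) h) : HasDirDeriv (fun τ : ℝ => f (x + τ • h)) L t 1 := by
  refine Tendsto.congr (fun τ => ?_) H
  simp [add_smul, add_assoc]

theorem HasDirDeriv.of_comp_line {f : E → F} {L : F} {x h : E}
    (H : HasDirDeriv (fun τ : ℝ => f (x + τ • h)) L 0 1) : HasDirDeriv f L x h := by
  refine Tendsto.congr (fun τ => ?_) H
  simp

theorem eventually_add_smul_mem {E : Type*} [AddCommGroup E] [Module ℝ E] [TopologicalSpace E]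
    [IsTopologicalAddGroup E] [ContinuousSMul ℝ E] {O : Set E} (hO : IsOpen O) {x : E}
    (hx : x ∈ O) (k : E) : ∀ᶠ z : E × ℝ in 𝓝 x ×ˢ 𝓝 0, z.1 + z.2 • k ∈ O := by
  have h := Continuous.tendsto (f := fun z : E × ℝ => z.1 + z.2 • k) (by fun_prop) (x, 0)
  rw [nhds_prod_eq] at h
  exact h.eventually (hO.mem_nhds (by simpa using hx))

variable [TopologicalSpace E] [IsTopologicalAddGroup E] [ContinuousSMul ℝ E]
  [IsTopologicalAddGroup F]

/-- Subtracting a linear term normalizes a derivative so that its limit is `0`; a limit depending on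
a parameter becomes the same for the whole family. -/
theorem HasDirDeriv.sub_const_smul {f : ℝ → F} {L : F} {t : ℝ} (H : HasDirDeriv f L t 1) (M : F) :
    HasDirDeriv (fun τ => f τ - τ • M) (L - M) t 1 := by
  refine (Tendsto.sub H (tendsto_const_nhds (x := M))).congr' ?_
  filter_upwards [self_mem_nhdsWithin] with τ hτ
  have h1 : τ⁻¹ • τ • M = M := inv_smul_smul₀ hτ M
  simp only [smul_eq_mul, mul_one, add_smul, smul_sub, smul_add, h1]
  abel

variable [ContinuousSMul ℝ F] [LocallyConvexSpace ℝ F]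

/-- Directional derivatives extend from a set `O` to points of its closure. -/
theorem HasDirDeriv.of_closure {O S : Set E} (hOS : O ⊆ S) {h h' : E → F} {k p : E}
    (hp : p ∈ S) (hpO : p ∈ closure O) (hc : ContinuousOn h S) (hc' : ContinuousOn h' S)
    (H : ∀ q ∈ O, HasDirDeriv h (h' q) q k)
    (hO : ∀ᶠ z : E × ℝ in 𝓝[O] p ×ˢ 𝓝 0, z.1 + z.2 • k ∈ O)
    (hS : ∀ᶠ t : ℝ in 𝓝 0, p + t • k ∈ S) : HasDirDeriv h (h' p) p k := by
  have : (𝓝[O] p).NeBot := mem_closure_iff_nhdsWithin_neBot.1 hpO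
  refine HasDirDeriv.of_comp_line (hasDirDeriv_zero_of_tendsto (l := 𝓝[O] p)
    (f := fun q t => h (q + t • k)) (f' := fun q t => h' (q + t • k)) ?_ ?_ ?_)
  · filter_upwards [hO] with z hz using (H _ hz).comp_line
  · refine (hc' p hp).tendsto.comp (tendsto_nhdsWithin_iff.2 ⟨?_, hO.mono fun z hz => hOS hz⟩)
    have : Tendsto (fun z : E × ℝ => z.1 + z.2 • k) (𝓝 p ×ˢ 𝓝 0) (𝓝 (p + (0 : ℝ) • k)) := by
      rw [← nhds_prod_eq]
      exact Continuous.tendsto (f := fun z : E × ℝ => z.1 + z.2 • k) (by fun_prop) (p, 0)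
    simp only [zero_smul, add_zero] at this
    exact this.mono_left (prod_mono_left _ nhdsWithin_le_nhds)
  -- With `t` fixed and `q → p`, continuity of `h` on `S` at `p + t • k` gives the pointwise limit.
  · filter_upwards [hS, (eventually_swap_iff.1 hO).curry] with t ht h1
    refine (hc _ ht).tendsto.comp (tendsto_nhdsWithin_iff.2 ⟨?_, h1.mono fun z hz => hOS hz⟩)
    exact Tendsto.mono_left (Continuous.tendsto (f := fun z : E => z + t • k) (by fun_prop) p)
      nhdsWithin_le_nhds

/-- A version of Schwarz' theorem: if `D_a D_b h` exists and is continuous, then it equals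
`D_b D_a h`. -/
theorem HasDirDeriv.schwarz {O : Set E} (hO : IsOpen O) {h ha hb hba : E → F} {a b : E}
    (Ha : ∀ p ∈ O, HasDirDeriv h (ha p) p a) (Hb : ∀ p ∈ O, HasDirDeriv h (hb p) p b)
    (Hba : ∀ p ∈ O, HasDirDeriv hb (hba p) p a) (hc : ContinuousOn hba O) {p : E} (hp : p ∈ O) :
    HasDirDeriv ha (hba p) p b := by
  have hT : Tendsto (fun z : ℝ × ℝ => p + z.1 • b + z.2 • a) (𝓝 0 ×ˢ 𝓝 0) (𝓝 p) := by
    rw [← nhds_prod_eq]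
    have := Continuous.tendsto (f := fun z : ℝ × ℝ => p + z.1 • b + z.2 • a) (by fun_prop) (0, 0)
    simpa using this
  have hev := hT.eventually (hO.mem_nhds hp)
  have hT1 : Tendsto (fun t : ℝ => p + t • b) (𝓝 0) (𝓝 p) := by
    have := Continuous.tendsto (f := fun t : ℝ => p + t • b) (by fun_prop) 0
    simpa using this
  have hev1 := hT1.eventually (hO.mem_nhds hp)
  -- The `a`-quotients of `hb` at `p + t • b` tend to `hba p` jointly in `t` and the step `s`.
  have key := tendsto_slope_of_tendsto_deriv (l := 𝓝 (0 : ℝ))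
    (f := fun t s => hb (p + t • b + s • a)) (f' := fun t s => hba (p + t • b + s • a))
    (hev.mono fun z hz => (Hba _ hz).comp_line)
    (((hc p hp).continuousAt (hO.mem_nhds hp)).tendsto.comp hT)
  -- The curves in `t` are the `a`-quotients of `h`, indexed by the step `s`. As `s → 0` they tend
  -- to `ha` along the `b`-line, while by `key` their derivatives tend to `hba p`.
  refine HasDirDeriv.of_comp_line (hasDirDeriv_zero_of_tendsto (l := 𝓝[≠] (0 : ℝ))
    (f := fun s t => s⁻¹ • (h (p + t • b + s • a) - h (p + t • b)))
    (f' := fun s t => s⁻¹ • (hb (p + t • b + s • a) - hb (p + t • b))) ?_ ?_ ?_)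
  · have h2 : ∀ᶠ z : ℝ × ℝ in 𝓝[≠] 0 ×ˢ 𝓝 0, p + z.2 • b + z.1 • a ∈ O :=
      (eventually_swap_iff.1 hev).filter_mono (prod_mono_left _ nhdsWithin_le_nhds)
    filter_upwards [h2, hev1.prod_inr _] with z hz hz1
    have e1 : HasDirDeriv (fun t : ℝ => h (p + t • b + z.1 • a)) (hb (p + z.2 • b + z.1 • a))
        z.2 1 := by
      have : HasDirDeriv h (hb (p + z.2 • b + z.1 • a)) ((p + z.1 • a) + z.2 • b) b := by
        have := Hb _ hz
        rwa [add_right_comm] at this ⊢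
      simpa only [add_right_comm] using this.comp_line
    have e2 := (Hb _ hz1).comp_line
    refine ((Tendsto.sub e1 e2).const_smul z.1⁻¹).congr fun τ => ?_
    simp only [← smul_sub]
    rw [smul_comm]
    congr 2
    abel
  · refine (key.comp tendsto_prod_swap).congr fun z => ?_
    simp
  · exact hev1.mono fun t ht => Ha _ ht

/-- Iterated directional derivatives from one-step derivatives. -/
theorem iterDirDeriv_of_step {E F : Type*} [AddCommGroup E] [Module ℝ E] [TopologicalSpace E]
    [IsTopologicalAddGroup E] [ContinuousSMul ℝ E]
    [AddCommGroup F] [Module ℝ F] [TopologicalSpace F] [T2Space F]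
    {O : Set E} (hO : IsOpen O) (K : (n : ℕ) → (Fin n → E) → E → F) (n : ℕ)
    (hK : ∀ m < n, ∀ y : Fin (m + 1) → E, ∀ x ∈ O,
      HasDirDeriv (K m fun a => y a.castSucc) (K (m + 1) y x) x (y (Fin.last m)))
    {f : E → F} (hf : ∀ y, Set.EqOn (K 0 y) f O) (y : Fin n → E) :
    IterDirDiffOn O f n y ∧ Set.EqOn (K n y) (iterDirDeriv f n y) O := by
  induction n with
  | zero => exact ⟨trivial, hf y⟩
  | succ n ih =>
    obtain ⟨h1, h2⟩ := ih (fun m hm => hK m (hm.trans n.lt_succ_self)) (fun a => y a.castSucc)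
    have h3 := fun x hx => (hK n n.lt_succ_self y x hx).congr hO h2 hx
    exact ⟨⟨h1, fun x hx => ⟨_, h3 x hx⟩⟩, fun x hx => (h3 x hx).dirDeriv_eq.symm⟩

end Directional

/-! ### Partial derivatives and extension by zero -/

section Sections

variable {E₁ E₂ F : Type*} [AddCommGroup E₁] [Module ℝ E₁] [AddCommGroup E₂] [Module ℝ E₂]
  [AddCommGroup F] [Module ℝ F] [TopologicalSpace F]

theorem HasDirDeriv.slice_fst {f : E₁ × E₂ → F} {L : F} {x : E₁} {y : E₂} {w : E₁}
    (H : HasDirDeriv f L (x, y) (w, 0)) : HasDirDeriv (fun x => f (x, y)) L x w := by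
  simpa [HasDirDeriv] using H

theorem HasDirDeriv.slice_snd {f : E₁ × E₂ → F} {L : F} {x : E₁} {y : E₂} {v : E₂}
    (H : HasDirDeriv f L (x, y) (0, v)) : HasDirDeriv (fun y => f (x, y)) L y v := by
  simpa [HasDirDeriv] using H

end Sections

theorem extZero_of_notMem {E F : Type*} [AddCommGroup E] [Module ℝ E]
    [TopologicalSpace E] [AddCommGroup F] {U : LCDomain E} (f : U → F) {x : E}
    (hx : x ∉ U.carrier) : extZero f x = 0 := by
  rw [extZero, Function.extend_apply' _ _ _ fun ⟨a, ha⟩ => hx (ha ▸ a.2)]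
  rfl

section Extensions

variable {E₁ E₂ F : Type*} [AddCommGroup E₁] [Module ℝ E₁] [TopologicalSpace E₁]
  [AddCommGroup E₂] [Module ℝ E₂] [TopologicalSpace E₂]
  [AddCommGroup F] [Module ℝ F] [TopologicalSpace F]
  {U : LCDomain E₁} {V : LCDomain E₂}

theorem continuousOn_extZero {f : U → F} (hf : Continuous f) :
    ContinuousOn (extZero f) U.carrier := by
  rw [continuousOn_iff_continuous_domRestrict]
  exact hf.congr fun x => (extZero_apply f x).symm

theorem continuousAt_extZero {f : U → F} (hf : Continuous f) {x : E₁}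
    (hx : x ∈ interior U.carrier) : ContinuousAt (extZero f) x :=
  (continuousOn_extZero hf).continuousAt (mem_interior_iff_mem_nhds.1 hx)

theorem continuousOn_extZero₂ {f : U × V → F} (hf : Continuous f) :
    ContinuousOn (extZero₂ f) (U.carrier ×ˢ V.carrier) := by
  rw [continuousOn_iff_continuous_domRestrict]
  have : Continuous fun p : ↥(U.carrier ×ˢ V.carrier) =>
      f (⟨p.1.1, p.2.1⟩, ⟨p.1.2, p.2.2⟩) := by fun_prop
  exact this.congr fun p => (extZero₂_apply f ⟨p.1.1, p.2.1⟩ ⟨p.1.2, p.2.2⟩).symm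

theorem extZero₂_of_notMem (f : U × V → F) {x : E₁} {y : E₂}
    (h : ¬ (x ∈ U.carrier ∧ y ∈ V.carrier)) : extZero₂ f (x, y) = 0 := by
  refine extZero₂_of_not f ?_
  rintro ⟨⟨a, b⟩, hab⟩
  obtain ⟨rfl, rfl⟩ := Prod.mk.inj hab
  exact h ⟨a.2, b.2⟩

theorem extZero_slice_snd (f : U × V → F) (x : U) :
    extZero (fun y : V => f (x, y)) = fun y => extZero₂ f (x, y) := by
  funext y
  by_cases hy : y ∈ V.carrier
  · exact (extZero_apply (fun y : V => f (x, y)) ⟨y, hy⟩).trans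
      (extZero₂_apply f x ⟨y, hy⟩).symm
  · rw [extZero_of_notMem _ hy, extZero₂_of_notMem _ fun h => hy h.2]

theorem IsDiffExt₂.unique [T2Space F] {f : U × V → F} {i j : ℕ}
    {g h : C(U × V × (Fin i → E₁) × (Fin j → E₂), F)} (hg : IsDiffExt₂ f i j g)
    (hh : IsDiffExt₂ f i j h) : g = h := by
  have hd := U.dense.prod (V.dense.prod (dense_univ (X := (Fin i → E₁) × (Fin j → E₂))))
  refine ContinuousMap.ext fun p => congrFun (g.continuous.ext_on hd h.continuous ?_) p
  rintro ⟨x, y, w, v⟩ ⟨hx, hy, -⟩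
  exact (hg x y hx hy w v).trans (hh x y hx hy w v).symm

end Extensions

/-! ### Derivative relations between the maps `d^{(i,j)} γ` -/

section Jets

variable {E₁ E₂ F : Type*} [AddCommGroup E₁] [Module ℝ E₁] [TopologicalSpace E₁]
  [AddCommGroup E₂] [Module ℝ E₂] [TopologicalSpace E₂]
  [AddCommGroup F] [Module ℝ F] [TopologicalSpace F]
  {U : LCDomain E₁} {V : LCDomain E₂} {r s : ℕ∞} {γ : U × V → F}

theorem IsCrs.diff_spec (hγ : IsCrs r s γ) (i j : ℕ) (hi : (i : ℕ∞) ≤ r) (hj : (j : ℕ∞) ≤ s) :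
    IsDiffExt₂ γ i j (hγ.diff i j hi hj) :=
  (hγ.2 i j hi hj).2.choose_spec

open Classical in
/-- The differential `d^{(i,j)} γ`, set to zero unless `i ≤ r` and `j ≤ s`. -/
noncomputable def IsCrs.jet (hγ : IsCrs r s γ) (i j : ℕ) :
    C(U × V × (Fin i → E₁) × (Fin j → E₂), F) :=
  if h : (i : ℕ∞) ≤ r ∧ (j : ℕ∞) ≤ s then hγ.diff i j h.1 h.2 else 0

/-- The map `d^{(i,j)} γ (·, ·, w, v)`, extended by zero. -/
noncomputable def IsCrs.jetExt (hγ : IsCrs r s γ) (i j : ℕ) (w : Fin i → E₁) (v : Fin j → E₂) :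
    E₁ × E₂ → F :=
  extZero₂ fun p : U × V => hγ.jet i j (p.1, p.2, w, v)

theorem IsCrs.jet_eq (hγ : IsCrs r s γ) {i j : ℕ} (hi : (i : ℕ∞) ≤ r) (hj : (j : ℕ∞) ≤ s) :
    hγ.jet i j = hγ.diff i j hi hj :=
  dif_pos ⟨hi, hj⟩

theorem IsCrs.jet_zero [T2Space F] (hγ : IsCrs r s γ) (x : U) (y : V) (w : Fin 0 → E₁)
    (v : Fin 0 → E₂) : hγ.jet 0 0 (x, y, w, v) = γ (x, y) := by
  let g : C(U × V × (Fin 0 → E₁) × (Fin 0 → E₂), F) :=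
    ⟨fun p => γ (p.1, p.2.1), hγ.1.comp (by fun_prop)⟩
  have hg : IsDiffExt₂ γ 0 0 g := fun x y _ _ _ _ => (extZero₂_apply γ x y).symm
  rw [hγ.jet_eq (by simp) (by simp), (hγ.diff_spec 0 0 (by simp) (by simp)).unique hg]
  rfl

theorem IsCrs.jetExt_apply (hγ : IsCrs r s γ) (i j : ℕ) (w : Fin i → E₁) (v : Fin j → E₂)
    (x : U) (y : V) : hγ.jetExt i j w v (x, y) = hγ.jet i j (x, y, w, v) :=
  extZero₂_apply _ x y

theorem IsCrs.continuousOn_jetExt (hγ : IsCrs r s γ) (i j : ℕ) (w : Fin i → E₁)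
    (v : Fin j → E₂) : ContinuousOn (hγ.jetExt i j w v) (U.carrier ×ˢ V.carrier) :=
  continuousOn_extZero₂ (by fun_prop)

theorem IsCrs.jetExt_eqOn (hγ : IsCrs r s γ) {i j : ℕ} (hi : (i : ℕ∞) ≤ r) (hj : (j : ℕ∞) ≤ s)
    (w : Fin i → E₁) (v : Fin j → E₂) :
    Set.EqOn (iterDirDeriv₂ (extZero₂ γ) i j w v) (hγ.jetExt i j w v) (interior₂ U V) := by
  rintro ⟨x, y⟩ ⟨hx, hy⟩
  have h1 := hγ.jetExt_apply i j w v ⟨x, interior_subset hx⟩ ⟨y, interior_subset hy⟩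
  have h2 := hγ.diff_spec i j hi hj ⟨x, interior_subset hx⟩ ⟨y, interior_subset hy⟩ hx hy w v
  exact h2.symm.trans ((hγ.jet_eq hi hj ▸ h1).symm)

theorem interior₂_subset : interior₂ U V ⊆ U.carrier ×ˢ V.carrier :=
  Set.prod_mono interior_subset interior_subset

theorem natCast_le_of_succ_le {i : ℕ} (h : ((i + 1 : ℕ) : ℕ∞) ≤ r) : (i : ℕ∞) ≤ r :=
  le_trans (by exact_mod_cast i.le_succ) h

variable [IsTopologicalAddGroup E₁] [ContinuousSMul ℝ E₁]
  [IsTopologicalAddGroup E₂] [ContinuousSMul ℝ E₂] [T2Space F]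

/-- The directions in the first variable are applied last, so this is the outermost step of the
defining iterated derivative. -/
theorem IsCrs.hasDirDeriv_fst (hγ : IsCrs r s γ) {i j : ℕ} (hi : ((i + 1 : ℕ) : ℕ∞) ≤ r)
    (hj : (j : ℕ∞) ≤ s) (w : Fin (i + 1) → E₁) (v : Fin j → E₂) {p : E₁ × E₂}
    (hp : p ∈ interior₂ U V) :
    HasDirDeriv (hγ.jetExt i j (fun a => w a.castSucc) v) (hγ.jetExt (i + 1) j w v p) p
      (w (Fin.last i), 0) := by
  obtain ⟨L, hL⟩ := (((hγ.2 (i + 1) j hi hj).1 w v).2).2 p hp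
  rw [← hγ.jetExt_eqOn hi hj w v hp]
  have h1 : iterDirDeriv₂ (extZero₂ γ) (i + 1) j w v p = L := hL.dirDeriv_eq
  rw [h1]
  exact hL.congr (isOpen_interior₂ U V) (hγ.jetExt_eqOn (natCast_le_of_succ_le hi) hj _ v) hp

theorem IsCrs.hasDirDeriv_snd_zero (hγ : IsCrs r s γ) {j : ℕ} (hj : ((j + 1 : ℕ) : ℕ∞) ≤ s)
    (w : Fin 0 → E₁) (v : Fin (j + 1) → E₂) {p : E₁ × E₂} (hp : p ∈ interior₂ U V) :
    HasDirDeriv (hγ.jetExt 0 j w fun a => v a.castSucc) (hγ.jetExt 0 (j + 1) w v p) p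
      (0, v (Fin.last j)) := by
  obtain ⟨L, hL⟩ := (((hγ.2 0 (j + 1) (by simp) hj).1 w v).1).2 p hp
  rw [← hγ.jetExt_eqOn (by simp) hj w v hp]
  have h1 : iterDirDeriv₂ (extZero₂ γ) 0 (j + 1) w v p = L := hL.dirDeriv_eq
  rw [h1]
  exact hL.congr (isOpen_interior₂ U V)
    (hγ.jetExt_eqOn (by simp) (natCast_le_of_succ_le hj) w _) hp

variable [IsTopologicalAddGroup F] [ContinuousSMul ℝ F] [LocallyConvexSpace ℝ F]

/-- The new direction in the second variable sits inside the derivatives in the first. Induction on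
`i` moves it outwards, one application of Schwarz' theorem per direction. -/
theorem IsCrs.hasDirDeriv_snd (hγ : IsCrs r s γ) {i j : ℕ} (hi : (i : ℕ∞) ≤ r)
    (hj : ((j + 1 : ℕ) : ℕ∞) ≤ s) (w : Fin i → E₁) (v : Fin (j + 1) → E₂) {p : E₁ × E₂}
    (hp : p ∈ interior₂ U V) :
    HasDirDeriv (hγ.jetExt i j w fun a => v a.castSucc) (hγ.jetExt i (j + 1) w v p) p
      (0, v (Fin.last j)) := by
  induction i generalizing p with
  | zero => exact hγ.hasDirDeriv_snd_zero hj w v hp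
  | succ i ih =>
    exact HasDirDeriv.schwarz (isOpen_interior₂ U V)
      (fun q hq => hγ.hasDirDeriv_fst hi (natCast_le_of_succ_le hj) w _ hq)
      (fun q hq => ih (natCast_le_of_succ_le hi) _ hq)
      (fun q hq => hγ.hasDirDeriv_fst hi hj w v hq)
      ((hγ.continuousOn_jetExt _ _ _ _).mono interior₂_subset) hp

/-- Allows `x` on the boundary, since `γ(x, ·)` has to be `C^s` for every `x ∈ U`. The relation is a
limit of those at interior points. -/
theorem IsCrs.hasDirDeriv_snd_of_mem (hγ : IsCrs r s γ) {i j : ℕ} (hi : (i : ℕ∞) ≤ r)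
    (hj : ((j + 1 : ℕ) : ℕ∞) ≤ s) (w : Fin i → E₁) (v : Fin (j + 1) → E₂) {x : E₁} {y : E₂}
    (hx : x ∈ U.carrier) (hy : y ∈ interior V.carrier) :
    HasDirDeriv (hγ.jetExt i j w fun a => v a.castSucc) (hγ.jetExt i (j + 1) w v (x, y)) (x, y)
      (0, v (Fin.last j)) := by
  have hev := eventually_add_smul_mem isOpen_interior hy (v (Fin.last j))
  refine HasDirDeriv.of_closure interior₂_subset
    ⟨hx, interior_subset hy⟩ ?_ (hγ.continuousOn_jetExt _ _ _ _) (hγ.continuousOn_jetExt _ _ _ _)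
    (fun q hq => hγ.hasDirDeriv_snd hi hj w v hq) ?_ ?_
  · rw [interior₂, closure_prod_eq]
    exact ⟨U.dense_interior hx, subset_closure hy⟩
  -- The increment moves only the second component, which starts near `y ∈ V°`; the first component
  -- stays in `U°`.
  · have h1 : ∀ᶠ z : (E₁ × E₂) × ℝ in 𝓝[interior₂ U V] (x, y) ×ˢ 𝓝 0,
        z.1.2 + z.2 • v (Fin.last j) ∈ interior V.carrier := by
      refine Tendsto.eventually (f := fun z : (E₁ × E₂) × ℝ => (z.1.2, z.2)) ?_ hev
      exact (((continuous_snd.tendsto (x, y)).mono_left nhdsWithin_le_nhds).comp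
        tendsto_fst).prodMk tendsto_snd
    filter_upwards [h1, (eventually_mem_nhdsWithin (a := (x, y))
      (s := interior₂ U V)).prod_inl _] with z hz hz'
    exact ⟨by simpa using hz'.1, by simpa using hz⟩
  · filter_upwards [(hev.curry).self_of_nhds] with t ht
    exact ⟨by simpa using hx, by simpa using interior_subset ht⟩

/-- Allows `y` on the boundary, since convergence in `C^s(V, F)` is tested on compact sets that may
meet the boundary of `V`. -/
theorem IsCrs.hasDirDeriv_fst_of_mem (hγ : IsCrs r s γ) {i j : ℕ} (hi : ((i + 1 : ℕ) : ℕ∞) ≤ r)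
    (hj : (j : ℕ∞) ≤ s) (w : Fin (i + 1) → E₁) (v : Fin j → E₂) {x : E₁} {y : E₂}
    (hx : x ∈ interior U.carrier) (hy : y ∈ V.carrier) :
    HasDirDeriv (hγ.jetExt i j (fun a => w a.castSucc) v) (hγ.jetExt (i + 1) j w v (x, y)) (x, y)
      (w (Fin.last i), 0) := by
  have hev := eventually_add_smul_mem isOpen_interior hx (w (Fin.last i))
  refine HasDirDeriv.of_closure interior₂_subset
    ⟨interior_subset hx, hy⟩ ?_ (hγ.continuousOn_jetExt _ _ _ _) (hγ.continuousOn_jetExt _ _ _ _)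
    (fun q hq => hγ.hasDirDeriv_fst hi hj w v hq) ?_ ?_
  · rw [interior₂, closure_prod_eq]
    exact ⟨subset_closure hx, V.dense_interior hy⟩
  · have h1 : ∀ᶠ z : (E₁ × E₂) × ℝ in 𝓝[interior₂ U V] (x, y) ×ˢ 𝓝 0,
        z.1.1 + z.2 • w (Fin.last i) ∈ interior U.carrier := by
      refine Tendsto.eventually (f := fun z : (E₁ × E₂) × ℝ => (z.1.1, z.2)) ?_ hev
      exact (((continuous_fst.tendsto (x, y)).mono_left nhdsWithin_le_nhds).comp
        tendsto_fst).prodMk tendsto_snd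
    filter_upwards [h1, (eventually_mem_nhdsWithin (a := (x, y))
      (s := interior₂ U V)).prod_inl _] with z hz hz'
    exact ⟨by simpa using hz, by simpa using hz'.2⟩
  · filter_upwards [(hev.curry).self_of_nhds] with t ht
    exact ⟨by simpa using interior_subset ht, by simpa using hy⟩

end Jets

/-! ### Convergence in the function spaces -/

/-- Uniform convergence on compact sets, written with the filter `𝓟 K` so that `K` can serve as the
index set of a family of curves. -/
theorem ContinuousMap.tendsto_nhds_iff_sub {ι X F : Type*} [TopologicalSpace X] [AddCommGroup F]
    [TopologicalSpace F] [IsTopologicalAddGroup F] {l : Filter ι} {f : ι → C(X, F)} {g : C(X, F)} :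
    Tendsto f l (𝓝 g) ↔ ∀ K : Set X, IsCompact K →
      Tendsto (fun p : ι × X => f p.1 p.2 - g p.2) (l ×ˢ 𝓟 K) (𝓝 0) := by
  rw [← tendsto_sub_nhds_zero_iff, ContinuousMap.tendsto_nhds_compactOpen]
  refine forall₂_congr fun K _ => ⟨fun h => ?_, fun h N hN h0 => ?_⟩
  · rw [tendsto_nhds]
    intro N hN h0
    exact eventually_prod_principal_iff.2 (h N hN fun _ _ => h0)
  · rcases K.eq_empty_or_nonempty with rfl | ⟨x, hx⟩
    · exact .of_forall fun _ => Set.mapsTo_empty _ _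
    · exact eventually_prod_principal_iff.1 (h.eventually (hN.mem_nhds (h0 hx)))

namespace CrMap

variable {E F : Type*} [AddCommGroup E] [Module ℝ E] [TopologicalSpace E]
  [IsTopologicalAddGroup E] [ContinuousSMul ℝ E]
  [AddCommGroup F] [Module ℝ F] [TopologicalSpace F]
  [IsTopologicalAddGroup F] [ContinuousSMul ℝ F] [T2Space F]
  {r : ℕ∞} {U : LCDomain E}

theorem tendsto_nhds_iff {ι : Type*} {l : Filter ι} {f : ι → CrMap r U F} {g : CrMap r U F} :
    Tendsto f l (𝓝 g) ↔ ∀ (k : ℕ) (hk : (k : ℕ∞) ≤ r),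
      Tendsto (fun a => diff k hk (f a)) l (𝓝 (diff k hk g)) := by
  have : 𝓝 g = ⨅ (k : ℕ) (hk : (k : ℕ∞) ≤ r), comap (diff k hk) (𝓝 (diff k hk g)) := by
    refine nhds_iInf.trans (iInf_congr fun k => nhds_iInf.trans (iInf_congr fun hk => ?_))
    exact nhds_induced _ _
  simp only [this, tendsto_iInf, tendsto_comap_iff, Function.comp_def]

theorem continuous_iff {X : Type*} [TopologicalSpace X] {f : X → CrMap r U F} :
    Continuous f ↔ ∀ (k : ℕ) (hk : (k : ℕ∞) ≤ r), Continuous fun a => diff k hk (f a) := by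
  simp only [continuous_iff_continuousAt, ContinuousAt, tendsto_nhds_iff]
  exact ⟨fun h k hk x => h x k hk, fun h x k hk => h k hk x⟩

theorem diff_eq {f : CrMap r U F} {k : ℕ} (hk : (k : ℕ∞) ≤ r) {g : C(U × (Fin k → E), F)}
    (hg : IsDiffExt (f : U → F) k g) : diff k hk f = g :=
  IsDiffExt.diff_eq f.isCr hk hg

end CrMap

/-! ### The curried map and its differentials -/

section Slices

variable {E₁ E₂ F : Type*} [AddCommGroup E₁] [Module ℝ E₁] [TopologicalSpace E₁]
  [IsTopologicalAddGroup E₁] [ContinuousSMul ℝ E₁]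
  [AddCommGroup E₂] [Module ℝ E₂] [TopologicalSpace E₂]
  [IsTopologicalAddGroup E₂] [ContinuousSMul ℝ E₂]
  [AddCommGroup F] [Module ℝ F] [TopologicalSpace F]
  [IsTopologicalAddGroup F] [ContinuousSMul ℝ F] [LocallyConvexSpace ℝ F] [T2Space F]
  {U : LCDomain E₁} {V : LCDomain E₂} {r s : ℕ∞} {γ : U × V → F}

/-- The map `(y, v) ↦ d^{(i,j)} γ (x, y, w, v)`. -/
noncomputable def IsCrs.jetSlice (hγ : IsCrs r s γ) (i j : ℕ) (x : U) (w : Fin i → E₁) :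
    C(V × (Fin j → E₂), F) :=
  ⟨fun p => hγ.jet i j (x, p.1, w, p.2), by fun_prop⟩

theorem IsCrs.iterDirDeriv_slice (hγ : IsCrs r s γ) {i j : ℕ} (hi : (i : ℕ∞) ≤ r)
    (hj : (j : ℕ∞) ≤ s) (x : U) (w : Fin i → E₁) (v : Fin j → E₂) :
    IterDirDiffOn (interior V.carrier) (extZero fun y : V => hγ.jet i 0 (x, y, w, 0)) j v ∧
      Set.EqOn (fun y => hγ.jetExt i j w v (x, y))
        (iterDirDeriv (extZero fun y : V => hγ.jet i 0 (x, y, w, 0)) j v) (interior V.carrier) := by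
  refine iterDirDeriv_of_step isOpen_interior (fun j v y => hγ.jetExt i j w v (x, y)) j
    (fun m hm v y hy => ?_) (fun v y _ => ?_) v
  · have hm' : ((m + 1 : ℕ) : ℕ∞) ≤ s := le_trans (by exact_mod_cast hm) hj
    exact (hγ.hasDirDeriv_snd_of_mem hi hm' w v x.2 hy).slice_snd
  · rw [Subsingleton.elim v 0]
    exact (congrFun (extZero_slice_snd (fun p : U × V => hγ.jet i 0 (p.1, p.2, w, 0)) x) y).symm

theorem IsCrs.isDiffExt_slice (hγ : IsCrs r s γ) {i j : ℕ} (hi : (i : ℕ∞) ≤ r)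
    (hj : (j : ℕ∞) ≤ s) (x : U) (w : Fin i → E₁) :
    IsDiffExt (fun y : V => hγ.jet i 0 (x, y, w, 0)) j (hγ.jetSlice i j x w) := by
  intro y hy v
  rw [← (hγ.iterDirDeriv_slice hi hj x w v).2 hy]
  exact (hγ.jetExt_apply i j w v x y).symm

theorem IsCrs.isCr_slice (hγ : IsCrs r s γ) {i : ℕ} (hi : (i : ℕ∞) ≤ r) (x : U)
    (w : Fin i → E₁) : IsCr s (fun y : V => hγ.jet i 0 (x, y, w, 0)) :=
  ⟨by fun_prop, fun _ hj => ⟨fun v => (hγ.iterDirDeriv_slice hi hj x w v).1, _,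
    hγ.isDiffExt_slice hi hj x w⟩⟩

/-- The `C^s`-map `y ↦ d^{(i,0)} γ (x, y, w)`, set to zero unless `i ≤ r`. -/
noncomputable def IsCrs.slice (hγ : IsCrs r s γ) (i : ℕ) (x : U) (w : Fin i → E₁) :
    CrMap s V F :=
  open Classical in
  if hi : (i : ℕ∞) ≤ r then CrMap.mk (fun y : V => hγ.jet i 0 (x, y, w, 0)) (hγ.isCr_slice hi x w)
  else 0

theorem IsCrs.slice_eq (hγ : IsCrs r s γ) {i : ℕ} (hi : (i : ℕ∞) ≤ r) (x : U)
    (w : Fin i → E₁) :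
    hγ.slice i x w = CrMap.mk (fun y : V => hγ.jet i 0 (x, y, w, 0)) (hγ.isCr_slice hi x w) :=
  dif_pos hi

theorem IsCrs.diff_slice (hγ : IsCrs r s γ) {i j : ℕ} (hi : (i : ℕ∞) ≤ r)
    (hj : (j : ℕ∞) ≤ s) (x : U) (w : Fin i → E₁) :
    CrMap.diff j hj (hγ.slice i x w) = hγ.jetSlice i j x w := by
  rw [hγ.slice_eq hi]
  exact CrMap.diff_eq hj (hγ.isDiffExt_slice hi hj x w)

/-- Each `d^{(j)}` of the slice is jointly continuous in all variables, hence continuous as a map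
into the compact-open topology. -/
theorem IsCrs.continuous_slice (hγ : IsCrs r s γ) {i : ℕ} (hi : (i : ℕ∞) ≤ r) :
    Continuous fun p : U × (Fin i → E₁) => hγ.slice i p.1 p.2 := by
  refine CrMap.continuous_iff.2 fun j hj => ?_
  simp only [hγ.diff_slice hi]
  refine ContinuousMap.continuous_of_continuous_uncurry _ ?_
  change Continuous fun q : (U × (Fin i → E₁)) × (V × (Fin j → E₂)) =>
    hγ.jet i j (q.1.1, q.2.1, q.1.2, q.2.2)
  fun_prop

/-- The two extensions by zero match at every `x : E₁`, so difference quotients can be computed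
without checking membership in `U`. -/
theorem IsCrs.diff_extZero_slice (hγ : IsCrs r s γ) {i j : ℕ} (hi : (i : ℕ∞) ≤ r)
    (hj : (j : ℕ∞) ≤ s) (x : E₁) (w : Fin i → E₁) (y : V) (v : Fin j → E₂) :
    CrMap.diff j hj (extZero (fun x : U => hγ.slice i x w) x) (y, v) =
      hγ.jetExt i j w v (x, y) := by
  by_cases hx : x ∈ U.carrier
  · lift x to U using hx
    rw [extZero_apply, hγ.diff_slice hi, hγ.jetExt_apply]
    rfl
  · rw [extZero_of_notMem _ hx, map_zero]
    exact (extZero₂_of_notMem _ fun h => hx h.1).symm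

/-- Continuity of the next slice gives uniform convergence of the derivatives on compact sets; the
mean value principle transfers it to the difference quotients. -/
theorem IsCrs.hasDirDeriv_slice (hγ : IsCrs r s γ) {i : ℕ} (hi : ((i + 1 : ℕ) : ℕ∞) ≤ r)
    (w : Fin (i + 1) → E₁) {x : E₁} (hx : x ∈ interior U.carrier) :
    HasDirDeriv (extZero fun x : U => hγ.slice i x fun a => w a.castSucc)
      (extZero (fun x : U => hγ.slice (i + 1) x w) x) x (w (Fin.last i)) := by
  have hi' := natCast_le_of_succ_le hi
  refine CrMap.tendsto_nhds_iff.2 fun j hj => ContinuousMap.tendsto_nhds_iff_sub.2 fun K hK => ?_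
  have hT : Tendsto (fun t : ℝ => x + t • w (Fin.last i)) (𝓝 0) (𝓝 x) := by
    have := Continuous.tendsto (f := fun t : ℝ => x + t • w (Fin.last i)) (by fun_prop) 0
    simpa using this
  have hcont : Continuous fun x : U => hγ.slice (i + 1) x w :=
    (hγ.continuous_slice hi).comp (f := fun x : U => (x, w)) (by fun_prop)
  have hder := ContinuousMap.tendsto_nhds_iff_sub.1 (CrMap.tendsto_nhds_iff.1
    ((continuousAt_extZero hcont hx).tendsto.comp hT) j hj) K hK
  -- The family is indexed by `q = (y, v) ∈ K`. The tangent term at `x` is subtracted so that the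
  -- limit is `0` for all `q`.
  have key := tendsto_slope_of_tendsto_deriv (l := 𝓟 K) (L := (0 : F))
    (f := fun q t => hγ.jetExt i j (fun a => w a.castSucc) q.2 (x + t • w (Fin.last i), q.1) -
      t • hγ.jetExt (i + 1) j w q.2 (x, q.1))
    (f' := fun q t => hγ.jetExt (i + 1) j w q.2 (x + t • w (Fin.last i), q.1) -
      hγ.jetExt (i + 1) j w q.2 (x, q.1)) ?_ ?_
  · refine ((key.comp tendsto_prod_swap).congr' ?_)
    have h0 : ∀ᶠ z : ℝ × (V × (Fin j → E₂)) in 𝓝[≠] 0 ×ˢ 𝓟 K, z.1 ≠ 0 :=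
      (eventually_mem_nhdsWithin (a := (0 : ℝ)) (s := {0}ᶜ)).prod_inl _
    filter_upwards [h0] with ⟨t, y, v⟩ ht
    simp only [Function.comp_apply, Prod.swap, map_smul, map_sub, ContinuousMap.smul_apply,
      ContinuousMap.sub_apply, hγ.diff_extZero_slice hi, hγ.diff_extZero_slice hi', zero_smul,
      add_zero, sub_zero]
    rw [sub_right_comm, smul_sub, inv_smul_smul₀ ht]
  · filter_upwards [(hT.eventually (isOpen_interior.mem_nhds hx)).prod_inr _] with ⟨⟨y, v⟩, t⟩ ht
    exact ((hγ.hasDirDeriv_fst_of_mem hi hj w v ht y.2).slice_fst.comp_line).sub_const_smul _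
  · refine (hder.comp tendsto_prod_swap).congr ?_
    rintro ⟨⟨y, v⟩, t⟩
    simp only [Function.comp_apply, Prod.swap, hγ.diff_extZero_slice hi]

theorem IsCrs.iterDirDeriv_curry (hγ : IsCrs r s γ) {i : ℕ} (hi : (i : ℕ∞) ≤ r)
    (w : Fin i → E₁) :
    IterDirDiffOn (interior U.carrier) (extZero fun x : U => hγ.slice 0 x 0) i w ∧
      Set.EqOn (extZero fun x : U => hγ.slice i x w)
        (iterDirDeriv (extZero fun x : U => hγ.slice 0 x 0) i w) (interior U.carrier) := by
  refine iterDirDeriv_of_step isOpen_interior (fun i w => extZero fun x : U => hγ.slice i x w) i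
    (fun m hm w x hx => hγ.hasDirDeriv_slice (le_trans (by exact_mod_cast hm) hi) w hx)
    (fun w x _ => ?_) w
  rw [Subsingleton.elim w 0]

theorem IsCrs.isDiffExt_curry (hγ : IsCrs r s γ) {i : ℕ} (hi : (i : ℕ∞) ≤ r) :
    IsDiffExt (fun x : U => hγ.slice 0 x 0) i ⟨_, hγ.continuous_slice hi⟩ := by
  intro x hx w
  rw [← (hγ.iterDirDeriv_curry hi w).2 hx, extZero_apply]
  rfl

theorem IsCrs.isCr_curry (hγ : IsCrs r s γ) : IsCr r (fun x : U => hγ.slice 0 x 0) :=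
  ⟨(hγ.continuous_slice (by simp)).comp (f := fun x : U => (x, 0)) (by fun_prop),
    fun _ hi => ⟨fun w => (hγ.iterDirDeriv_curry hi w).1, _, hγ.isDiffExt_curry hi⟩⟩

theorem IsCrs.slice_zero_apply (hγ : IsCrs r s γ) (x : U) (y : V) :
    hγ.slice 0 x 0 y = γ (x, y) := by
  rw [hγ.slice_eq (by simp)]
  exact hγ.jet_zero x y 0 0

theorem IsCrs.isCr_section (hγ : IsCrs r s γ) (x : U) : IsCr s (fun y : V => γ (x, y)) := by
  rw [← funext (hγ.slice_zero_apply x)]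
  exact CrMap.isCr _

end Slices

/-! ### Comparison of the topologies -/

namespace CrsMap

variable {E₁ E₂ F : Type*} [AddCommGroup E₁] [Module ℝ E₁] [TopologicalSpace E₁]
  [IsTopologicalAddGroup E₁] [ContinuousSMul ℝ E₁]
  [AddCommGroup E₂] [Module ℝ E₂] [TopologicalSpace E₂]
  [IsTopologicalAddGroup E₂] [ContinuousSMul ℝ E₂]
  [AddCommGroup F] [Module ℝ F] [TopologicalSpace F]
  [IsTopologicalAddGroup F] [ContinuousSMul ℝ F] [T2Space F]
  {U : LCDomain E₁} {V : LCDomain E₂} {r s : ℕ∞}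

/-- The additive map `d^{(i,j)} : C^{r,s}(U × V, F) → C(U × V × E₁^i × E₂^j, F)`. -/
noncomputable def diff (i j : ℕ) (hi : (i : ℕ∞) ≤ r) (hj : (j : ℕ∞) ≤ s) :
    CrsMap r s U V F →+ C(U × V × (Fin i → E₁) × (Fin j → E₂), F) :=
  AddMonoidHom.mk' (fun f => f.isCrs.diff i j hi hj) fun f g => by
    refine ((f + g).isCrs.diff_spec i j hi hj).unique fun x y hx hy w v => ?_
    have h := (iterDirDeriv₂_add (isOpen_interior₂ U V) i j w v ((f.isCrs.2 i j hi hj).1 w v)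
      ((g.isCrs.2 i j hi hj).1 w v)).2 (x := ((x : E₁), (y : E₂))) ⟨hx, hy⟩
    rw [ContinuousMap.add_apply, f.isCrs.diff_spec i j hi hj x y hx hy w v,
      g.isCrs.diff_spec i j hi hj x y hx hy w v]
    refine h.trans ?_
    rw [← extZero₂_add]
    rfl

instance : IsTopologicalAddGroup (CrsMap r s U V F) :=
  topologicalAddGroup_iInf fun i => topologicalAddGroup_iInf fun j =>
    topologicalAddGroup_iInf fun hi => topologicalAddGroup_iInf fun hj =>
      topologicalAddGroup_induced (diff (F := F) (U := U) (V := V) i j hi hj)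

theorem tendsto_nhds_iff {ι : Type*} {l : Filter ι} {f : ι → CrsMap r s U V F}
    {g : CrsMap r s U V F} :
    Tendsto f l (𝓝 g) ↔ ∀ (i j : ℕ) (hi : (i : ℕ∞) ≤ r) (hj : (j : ℕ∞) ≤ s),
      Tendsto (fun a => diff i j hi hj (f a)) l (𝓝 (diff i j hi hj g)) := by
  have : 𝓝 g = ⨅ (i : ℕ) (j : ℕ) (hi : (i : ℕ∞) ≤ r) (hj : (j : ℕ∞) ≤ s),
      comap (diff i j hi hj) (𝓝 (diff i j hi hj g)) := by
    refine nhds_iInf.trans (iInf_congr fun i => nhds_iInf.trans (iInf_congr fun j =>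
      nhds_iInf.trans (iInf_congr fun hi => nhds_iInf.trans (iInf_congr fun hj => ?_))))
    exact nhds_induced _ _
  simp only [this, tendsto_iInf, tendsto_comap_iff, Function.comp_def]

theorem tendsto_nhds_zero_iff {ι : Type*} {l : Filter ι} {f : ι → CrsMap r s U V F} :
    Tendsto f l (𝓝 0) ↔ ∀ (i j : ℕ) (hi : (i : ℕ∞) ≤ r) (hj : (j : ℕ∞) ≤ s),
      ∀ K : Set (U × V × (Fin i → E₁) × (Fin j → E₂)), IsCompact K →
        Tendsto (fun p : ι × (U × V × (Fin i → E₁) × (Fin j → E₂)) => diff i j hi hj (f p.1) p.2)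
          (l ×ˢ 𝓟 K) (𝓝 0) := by
  simp [tendsto_nhds_iff, ContinuousMap.tendsto_nhds_iff_sub]

variable [LocallyConvexSpace ℝ F]

/-- The linear map `γ ↦ (x ↦ γ (x, ·))` from `C^{r,s}(U × V, F)` to `C^r(U, C^s(V, F))`. -/
noncomputable def curry : CrsMap r s U V F →ₗ[ℝ] CrMap r U (CrMap s V F) where
  toFun γ := CrMap.mk (fun x => γ.isCrs.slice 0 x 0) γ.isCrs.isCr_curry
  map_add' γ η := by
    refine Subtype.ext (funext fun x => Subtype.ext (funext fun y => ?_))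
    exact ((γ + η).isCrs.slice_zero_apply x y).trans (congrArg₂ (· + ·)
      (γ.isCrs.slice_zero_apply x y) (η.isCrs.slice_zero_apply x y)).symm
  map_smul' c γ := by
    refine Subtype.ext (funext fun x => Subtype.ext (funext fun y => ?_))
    exact ((c • γ).isCrs.slice_zero_apply x y).trans
      (congrArg (c • ·) (γ.isCrs.slice_zero_apply x y)).symm

theorem curry_apply (γ : CrsMap r s U V F) (x : U) (y : V) : curry γ x y = γ (x, y) :=
  γ.isCrs.slice_zero_apply x y

theorem curry_injective : Function.Injective (curry (F := F) (U := U) (V := V) (r := r) (s := s)) :=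
  fun γ η h => Subtype.ext (funext fun ⟨x, y⟩ => by
    rw [← curry_apply, h, curry_apply])

/-- The bridge between the topologies: the maps defining them are the same functions up to
regrouping variables. -/
theorem diff_diff_curry (γ : CrsMap r s U V F) {i j : ℕ} (hi : (i : ℕ∞) ≤ r) (hj : (j : ℕ∞) ≤ s)
    (x : U) (y : V) (w : Fin i → E₁) (v : Fin j → E₂) :
    CrMap.diff j hj (CrMap.diff i hi (curry γ) (x, w)) (y, v) = diff i j hi hj γ (x, y, w, v) := by
  have h : CrMap.diff i hi (curry γ) = ⟨_, γ.isCrs.continuous_slice hi⟩ :=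
    CrMap.diff_eq hi (γ.isCrs.isDiffExt_curry hi)
  have h' : CrMap.diff i hi (curry γ) (x, w) = γ.isCrs.slice i x w := DFunLike.congr_fun h (x, w)
  rw [h', γ.isCrs.diff_slice hi]
  exact congrArg (fun q : C(U × V × (Fin i → E₁) × (Fin j → E₂), F) => q (x, y, w, v))
    (γ.isCrs.jet_eq hi hj)

theorem tendsto_curry_nhds_zero_iff {ι : Type*} {l : Filter ι} {f : ι → CrsMap r s U V F} :
    Tendsto (fun a => curry (f a)) l (𝓝 0) ↔ ∀ (i : ℕ) (hi : (i : ℕ∞) ≤ r),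
      ∀ K : Set (U × (Fin i → E₁)), IsCompact K → ∀ (j : ℕ) (hj : (j : ℕ∞) ≤ s),
      ∀ M : Set (V × (Fin j → E₂)), IsCompact M →
        Tendsto (fun p : (ι × (U × (Fin i → E₁))) × (V × (Fin j → E₂)) =>
          diff i j hi hj (f p.1.1) (p.1.2.1, p.2.1, p.1.2.2, p.2.2))
          ((l ×ˢ 𝓟 K) ×ˢ 𝓟 M) (𝓝 0) := by
  simp [CrMap.tendsto_nhds_iff, ContinuousMap.tendsto_nhds_iff_sub, ← diff_diff_curry]

theorem tendsto_curry_nhds_zero_iff_tendsto {ι : Type*} {l : Filter ι}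
    {f : ι → CrsMap r s U V F} :
    Tendsto (fun a => curry (f a)) l (𝓝 0) ↔ Tendsto f l (𝓝 0) := by
  rw [tendsto_curry_nhds_zero_iff, tendsto_nhds_zero_iff]
  refine ⟨fun h i j hi hj K hK => ?_, fun h i hi K hK j hj M hM => ?_⟩
  -- `K` is contained in the regrouped product of its projections to `(x, w)` and `(y, v)`, both
  -- compact.
  · have h1 := h i hi ((fun q => (q.1, q.2.2.1)) '' K) (hK.image (by fun_prop)) j hj
      ((fun q => (q.2.1, q.2.2.2)) '' K) (hK.image (by fun_prop))
    refine h1.comp (f := fun p : ι × (U × V × (Fin i → E₁) × (Fin j → E₂)) =>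
      ((p.1, (p.2.1, p.2.2.2.1)), (p.2.2.1, p.2.2.2.2))) ?_
    have hm : ∀ᶠ p : ι × (U × V × (Fin i → E₁) × (Fin j → E₂)) in l ×ˢ 𝓟 K, p.2 ∈ K :=
      (eventually_principal.2 fun _ h => h : ∀ᶠ q in 𝓟 K, q ∈ K).prod_inr _
    refine (tendsto_fst.prodMk (tendsto_principal.2 ?_)).prodMk (tendsto_principal.2 ?_)
    · exact hm.mono fun p hp => ⟨p.2, hp, rfl⟩
    · exact hm.mono fun p hp => ⟨p.2, hp, rfl⟩
  · have h1 := h i j hi hj ((fun q : (U × (Fin i → E₁)) × (V × (Fin j → E₂)) =>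
      (q.1.1, q.2.1, q.1.2, q.2.2)) '' (K ×ˢ M)) ((hK.prod hM).image (by fun_prop))
    refine h1.comp (f := fun p : (ι × (U × (Fin i → E₁))) × (V × (Fin j → E₂)) =>
      (p.1.1, (p.1.2.1, p.2.1, p.1.2.2, p.2.2))) ?_
    refine (tendsto_fst.comp tendsto_fst).prodMk (tendsto_principal.2 ?_)
    have hm : ∀ᶠ p : (ι × (U × (Fin i → E₁))) × (V × (Fin j → E₂)) in (l ×ˢ 𝓟 K) ×ˢ 𝓟 M,
        p.1.2 ∈ K ∧ p.2 ∈ M :=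
      (((eventually_principal.2 fun _ h => h : ∀ᶠ q in 𝓟 K, q ∈ K).prod_inr _).prod_inl _).and ((eventually_principal.2 fun _ h => h : ∀ᶠ q in 𝓟 M, q ∈ M).prod_inr _)
    exact hm.mono fun p hp => ⟨(p.1.2, p.2), hp, rfl⟩

/-- For an additive map, inducing need only be checked at `0`. The convergence criterion holds for
every filter; `𝓝 0` and the pullback of `𝓝 0` give the two inclusions. -/
theorem isEmbedding_curry :
    IsEmbedding (curry (F := F) (U := U) (V := V) (r := r) (s := s)) := by
  refine ⟨IsTopologicalAddGroup.isInducing_iff_nhds_zero.2 (le_antisymm ?_ ?_), curry_injective⟩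
  · exact tendsto_iff_comap.1 (tendsto_curry_nhds_zero_iff_tendsto.2 tendsto_id)
  · exact tendsto_curry_nhds_zero_iff_tendsto.1 tendsto_comap

end CrsMap

/-! ### The theorem -/

theorem mainTheorem2
    {E₁ E₂ F : Type*}
    [AddCommGroup E₁] [Module ℝ E₁] [TopologicalSpace E₁] [IsTopologicalAddGroup E₁]
    [ContinuousSMul ℝ E₁] [LocallyConvexSpace ℝ E₁]
    [AddCommGroup E₂] [Module ℝ E₂] [TopologicalSpace E₂] [IsTopologicalAddGroup E₂]
    [ContinuousSMul ℝ E₂] [LocallyConvexSpace ℝ E₂]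
    [AddCommGroup F] [Module ℝ F] [TopologicalSpace F] [IsTopologicalAddGroup F]
    [ContinuousSMul ℝ F] [LocallyConvexSpace ℝ F] [T2Space F]
    (U : LCDomain E₁) (V : LCDomain E₂) (r s : ℕ∞) :
    (∀ γ : U × V → F, IsCrs r s γ →
      ∃ h : ∀ x : U, IsCr s (fun y : V => γ (x, y)),
        IsCr r (fun x : U => CrMap.mk (fun y : V => γ (x, y)) (h x))) ∧
    ∃ Φ : CrsMap r s U V F →ₗ[ℝ] CrMap r U (CrMap s V F),
      (∀ (γ : CrsMap r s U V F) (x : U) (y : V), (Φ γ) x y = γ (x, y)) ∧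
      IsEmbedding Φ := by
  refine ⟨fun γ hγ => ⟨hγ.isCr_section, ?_⟩, CrsMap.curry, CrsMap.curry_apply,
    CrsMap.isEmbedding_curry⟩
  have h : (fun x : U => CrMap.mk (fun y : V => γ (x, y)) (hγ.isCr_section x)) =
      fun x => hγ.slice 0 x 0 :=
    funext fun x => Subtype.ext (funext fun y => (hγ.slice_zero_apply x y).symm)
  rw [h]
  exact hγ.isCr_curry
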